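/- For a positive integer $n$ and a permutation $\pi=(\pi_1,\dots,\pi_n)$ of $\{1,\dots,n\}$ let $na(\pi)=\sum_{i=1}^n|\pi_i-i|$ (Spearman's footrule). Let $\pi$ be uniformly random in $S_n$, and for an integer $r\ge 1$ let $$m_r(n)=\frac1{n!}\sum_{\pi\in S_n}\bigl(na(\pi)-\mu_n\bigr)^r,\qquad \mu_n=\frac1{n!}\sum_{\pi\in S_n}na(\pi),$$ be the $r$-th moment of $na$ about its mean. Then for every $3\le r\le 10$ there is a polynomial $P_r\in\mathbb{Q}[x]$ of degree exactly $\lfloor 3r/2\rfloor$ such that $m_r(n)=P_r(n)$ for all integers $n\ge r$. Explicitly, for all $n\ge r$ (where $r$ is the index of the moment in each line), $$\begin{aligned} m_{3}(n) &= -\frac{2(n+2)(n+1)}{945}\bigl(2n^{2} + 31\bigr),\\ m_{4}(n) &= \frac{(n+1)}{4725}\bigl(28n^{5} + 180n^{3} + 160n^{2} + 887n + 1265\bigr),\\ m_{5}(n) &= -\frac{4(n+2)(n+1)}{93555}\bigl(44n^{5} - 10n^{4} + 788n^{3} + 86n^{2} + 3587n + 8555\bigr),\\ m_{6}(n) &=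 \frac{(n+1)}{127702575}\bigl(168168n^{8} - 145288n^{7} + 1800148n^{6} + 2180892n^{5} + 18508182n^{4} + 32547228n^{3} + 112117257n^{2} + 385870348n + 368963105\bigr),\\ m_{7}(n) &= -\frac{2(n+2)(n+1)}{18243225}\bigl(8008n^{8} - 11648n^{7} + 171164n^{6} - 88560n^{5} + 1645002n^{4} + 2988888n^{3} + 4890161n^{2} + 46078520n + 73541545\bigr),\\ m_{8}(n) &= \frac{(n+1)}{13956067125}\bigl(5717712n^{11} - 14041456n^{10} + 111237120n^{9} + 63288800n^{8} + 1347724536n^{7} + 1996817312n^{6} + 17098013040n^{5} + 53375545600n^{4} + 125630091477n^{3} + 758605059019n^{2} + 2016696623115n + 1690532291725\bigr),\\ m_{9}(n) &= -\frac{8(n+2)(n+1)}{5568470782875}\bigl(325909584n^{11} - 1185159352n^{10} + 9805807128n^{9} - 16336808896n^{8} + 137996736504n^{7} + 46247875310n^{6} + 758421298152n^{5} + 6095266855096n^{4} + 6075969746037n^{3} + 57909124031467n^{2} + 310708670730195n + 412170672282775\bigr),\\ m_{10}(n) &= \frac{(n+1)}{102088631019375}\bigl(16730025312n^{14} - 77618212672n^{13}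 + 613234099632n^{12} - 579463689632n^{11} + 7657390179296n^{10} + 4566116902864n^{9} + 146567796905816n^{8} + 264922488779784n^{7} + 1660374425319302n^{6} + 11150634041788208n^{5} + 25328167884268777n^{4} + 156189484242864248n^{3} + 877883775625389940n^{2} + 1953357983931868000n + 1484183419415591125\bigr). \end{aligned}$$ -/

import Mathlib

open Polynomial

/-- Spearman's footrule `na(π) = ∑ |π_i - i|` of a permutation `π` of `n` letters. The letters are
indexed by `0, …, n - 1` instead of `1, …, n`, which does not affect the differences `π_i - i`. -/
def footrule {n : ℕ} (π : Equiv.Perm (Fin n)) : ℤ :=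
  ∑ i : Fin n, |((π i : ℕ) : ℤ) - ((i : ℕ) : ℤ)|

/-- The expectation of the random variable `f` on the finite set `A`, when an element of `A` is
drawn uniformly at random. -/
def uniformMean {A : Type*} [Fintype A] (f : A → ℚ) : ℚ :=
  (∑ a, f a) / (Fintype.card A : ℚ)

/-- The `r`-th moment about the mean of `f`, when an element of the finite set `A` is drawn
uniformly at random. -/
def uniformCentralMoment {A : Type*} [Fintype A] (f : A → ℚ) (r : ℕ) : ℚ :=
  uniformMean fun a => (f a - uniformMean f) ^ r

/-- The `r`-th moment about the mean of Spearman's footrule on a uniformly random permutation of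
`n` letters. -/
def footruleMoment (n r : ℕ) : ℚ :=
  uniformCentralMoment (fun π : Equiv.Perm (Fin n) => (footrule π : ℚ)) r

/-!
Write `H k` for the number of letters below `k` that a permutation `π` of `n` letters sends to `k`
or above. The footrule is `2 * ∑ k, H k` (`footrule_eq_two_mul_sum_crossings`), so three times the
footrule minus its mean `(n ^ 2 - 1) / 3` is the value `s n` of the partial sums
`s k = 6 * (H 1 + ⋯ + H k) - (k ^ 2 - 1)`.

Let `F j g` be the sum of `g` over the permutations that fix the letters below `j`. If `g` is
invariant under permuting the letters below `k` on either side, then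
`F j (H k * g) = (k - j) * F j g - (k - j) ^ 2 * F (j + 1) g` for `j ≤ k`
(`fixingSum_crossings_mul`): each of the `k - j` letters from `j` to `k - 1` crosses level `k`
unless it is sent to one of the `k - j` positions from `j` to `k - 1`, and by invariance each of
these `(k - j) ^ 2` events weighs as much as the event that `j` is fixed. As `H k` has this
invariance, one can multiply out the powers of `s k` level by level, and finds
`∑ π, s k ^ r * g = ∑ j, v k r j * F j g` with coefficients `v` given by a recurrence
(`powerCoeff`, `represents_powerCoeff`). For `g = 1` and `k = n` this reads
`∑ π, s n ^ r = ∑ j, v n r j * (n - j)!`.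

The recurrence shows that `v k r j` is a polynomial in `k` of degree at most `2 * r + j`
(`isPolyFamily_powerCoeff`), and that it vanishes for `k < j` and for `r < j`. Hence it is divisible
by the falling factorial `k * (k - 1) * ⋯ * (k - j + 1)`, and for `r ≤ n` the `r`-th central moment
`3⁻¹ ^ r * ∑ j ≤ r, v n r j * (n - j)! / n!` is a polynomial in `n` of degree at most `2 * r`
(`exists_poly_powerSum`). An explicit formula of at most this degree is therefore correct as soon as
it is correct for `r ≤ n ≤ 3 * r`, and there the recurrence can be evaluated in integer arithmetic
(`coeffTable`, `checkPowerSums`).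
-/

/-! ### The level-crossing decomposition of the footrule -/

/-- The number of letters below `k` that `π` sends to a position at or above `k`. -/
def crossings {n : ℕ} (k : ℕ) (π : Equiv.Perm (Fin n)) : ℤ :=
  ∑ i : Fin n, if (i : ℕ) < k ∧ k ≤ (π i : ℕ) then 1 else 0

/-- Six times the number of crossings of the levels up to `k`, minus `k ^ 2 - 1`. At `k = n` this is
three times the footrule minus its mean `(n ^ 2 - 1) / 3`; the factors keep everything integral. -/
def centredCrossings {n : ℕ} (k : ℕ) (π : Equiv.Perm (Fin n)) : ℤ :=
  6 * ∑ l ∈ Finset.range (k + 1), crossings l π - ((k : ℤ) ^ 2 - 1)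

/-- The increment of `centredCrossings` from level `k - 1` to level `k`. -/
def crossingIncrement {n : ℕ} (k : ℕ) (π : Equiv.Perm (Fin n)) : ℤ :=
  6 * crossings k π - (2 * (k : ℤ) - 1)

lemma centredCrossings_zero {n : ℕ} (π : Equiv.Perm (Fin n)) : centredCrossings 0 π = 1 := by
  simp [centredCrossings, crossings]

lemma centredCrossings_succ {n : ℕ} (k : ℕ) (π : Equiv.Perm (Fin n)) :
    centredCrossings (k + 1) π = centredCrossings k π + crossingIncrement (k + 1) π := by
  simp only [centredCrossings, crossingIncrement, Finset.sum_range_succ _ (k + 1)]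
  push_cast
  ring

/-- A displacement from `i` to `π i > i` crosses exactly `π i - i` levels upwards, and the upward
displacements make up half of the footrule because all displacements sum to zero. -/
lemma footrule_eq_two_mul_sum_crossings {n : ℕ} (π : Equiv.Perm (Fin n)) :
    footrule π = 2 * ∑ k ∈ Finset.range (n + 1), crossings k π := by
  have hcount : ∀ i : Fin n, (∑ k ∈ Finset.range (n + 1),
      if (i : ℕ) < k ∧ k ≤ (π i : ℕ) then (1 : ℤ) else 0) = ((π i : ℕ) - (i : ℕ) : ℕ) := by
    intro i
    rw [Finset.sum_boole]
    have : (Finset.range (n + 1)).filter (fun k => (i : ℕ) < k ∧ k ≤ (π i : ℕ)) =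
        Finset.Ioc (i : ℕ) (π i : ℕ) := by
      ext k
      have := (π i).isLt
      simp only [Finset.mem_filter, Finset.mem_range, Finset.mem_Ioc]
      omega
    rw [this, Nat.card_Ioc]
  have hzero : ∑ i : Fin n, (((π i : ℕ) : ℤ) - ((i : ℕ) : ℤ)) = 0 := by
    rw [Finset.sum_sub_distrib, Equiv.sum_comp π (fun i : Fin n => ((i : ℕ) : ℤ)), sub_self]
  simp only [crossings]
  rw [Finset.sum_comm, Finset.sum_congr rfl (fun i _ => hcount i), footrule, Finset.mul_sum,
    ← sub_eq_zero, ← Finset.sum_sub_distrib, ← neg_eq_zero, ← Finset.sum_neg_distrib, ← hzero]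
  refine Finset.sum_congr rfl fun i _ => ?_
  rcases le_total (π i : ℕ) (i : ℕ) with h | h
  · rw [abs_of_nonpos (by omega)]
    omega
  · rw [abs_of_nonneg (by omega)]
    omega

lemma centredCrossings_self {n : ℕ} (π : Equiv.Perm (Fin n)) :
    centredCrossings n π = 3 * footrule π - ((n : ℤ) ^ 2 - 1) := by
  rw [footrule_eq_two_mul_sum_crossings, centredCrossings]
  ring

/-! ### Symmetrized sums over permutations -/

/-- Invariance of a function on permutations under permuting the letters and the positions
below `k`. -/
def InvariantBelow {n : ℕ} (k : ℕ) (g : Equiv.Perm (Fin n) → ℤ) : Prop :=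
  ∀ a b : Fin n, (a : ℕ) < k → (b : ℕ) < k → ∀ π,
    g (Equiv.swap a b * π) = g π ∧ g (π * Equiv.swap a b) = g π

lemma InvariantBelow.mono {n k l : ℕ} {g : Equiv.Perm (Fin n) → ℤ} (hg : InvariantBelow l g)
    (h : k ≤ l) : InvariantBelow k g :=
  fun a b ha hb => hg a b (ha.trans_le h) (hb.trans_le h)

lemma InvariantBelow.mul {n k : ℕ} {f g : Equiv.Perm (Fin n) → ℤ} (hf : InvariantBelow k f)
    (hg : InvariantBelow k g) : InvariantBelow k (fun π => f π * g π) := fun a b ha hb π => by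
  simp only [(hf a b ha hb π).1, (hf a b ha hb π).2, (hg a b ha hb π).1, (hg a b ha hb π).2,
    and_self]

lemma swap_val_lt_iff {n k : ℕ} {a b : Fin n} (ha : (a : ℕ) < k) (hb : (b : ℕ) < k) (x : Fin n) :
    (Equiv.swap a b x : ℕ) < k ↔ (x : ℕ) < k := by
  rw [Equiv.swap_apply_def]
  split_ifs with h1 h2
  · subst h1; simp [ha, hb]
  · subst h2; simp [ha, hb]
  · rfl

lemma invariantBelow_crossings {n : ℕ} (k : ℕ) :
    InvariantBelow k (crossings k : Equiv.Perm (Fin n) → ℤ) := by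
  intro a b ha hb π
  constructor
  · simp only [crossings, Equiv.Perm.mul_apply, ← not_lt, swap_val_lt_iff ha hb]
  · rw [crossings, crossings, ← Equiv.sum_comp (Equiv.swap a b)]
    simp only [Equiv.Perm.mul_apply, Equiv.swap_apply_self, swap_val_lt_iff ha hb]

lemma invariantBelow_crossingIncrement {n : ℕ} (k : ℕ) :
    InvariantBelow k (crossingIncrement k : Equiv.Perm (Fin n) → ℤ) := by
  intro a b ha hb π
  simp only [crossingIncrement, (invariantBelow_crossings k a b ha hb π).1,
    (invariantBelow_crossings k a b ha hb π).2, and_self]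

/-- The sum of `g` over the permutations that fix every letter below `j`. -/
def fixingSum {n : ℕ} (j : ℕ) (g : Equiv.Perm (Fin n) → ℤ) : ℤ :=
  ∑ π : Equiv.Perm (Fin n), if ∀ i : Fin n, (i : ℕ) < j → π i = i then g π else 0

lemma fixingSum_zero {n : ℕ} (g : Equiv.Perm (Fin n) → ℤ) : fixingSum 0 g = ∑ π, g π := by
  simp [fixingSum]

lemma fixingSum_one {n j : ℕ} (hj : j ≤ n) :
    fixingSum j (fun _ : Equiv.Perm (Fin n) => 1) = ((n - j).factorial : ℤ) := by
  have h := Fintype.card_congr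
    (Equiv.Perm.subtypeEquivSubtypePerm (fun i : Fin n => ¬ (i : ℕ) < j))
  simp only [not_not] at h
  rw [fixingSum, Finset.sum_boole, ← Fintype.card_subtype, ← h, Fintype.card_perm,
    Fintype.card_subtype_compl, Fintype.card_fin, Fintype.card_subtype]
  congr 3
  rw [Fin.card_filter_val_lt]
  simp [hj]

/-- Conjugating by two swaps moves the requirement `π a = b` onto the letter `j`. -/
lemma sum_fixing_apply_eq {n k j : ℕ} {g : Equiv.Perm (Fin n) → ℤ} (hg : InvariantBelow k g)
    (hk : k ≤ n) (hj : j < k) {a b : Fin n} (ha : j ≤ (a : ℕ)) (hak : (a : ℕ) < k)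
    (hb : j ≤ (b : ℕ)) (hbk : (b : ℕ) < k) :
    (∑ π : Equiv.Perm (Fin n),
      if (∀ i : Fin n, (i : ℕ) < j → π i = i) ∧ π a = b then g π else 0) =
      fixingSum (j + 1) g := by
  set c : Fin n := ⟨j, hj.trans_le hk⟩ with hc
  have hfix : ∀ x : Fin n, j ≤ (x : ℕ) → ∀ i : Fin n, (i : ℕ) < j → Equiv.swap c x i = i := by
    intro x hx i hi
    apply Equiv.swap_apply_of_ne_of_ne
    · rintro rfl
      simp [hc] at hi
    · rintro rfl
      omega
  rw [fixingSum, ← Equiv.sum_comp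
    ((Equiv.mulLeft (Equiv.swap c b)).trans (Equiv.mulRight (Equiv.swap c a)))]
  refine Finset.sum_congr rfl fun π _ => ?_
  have hgπ : g (Equiv.swap c b * π * Equiv.swap c a) = g π := by
    rw [(hg c a hj hak _).2, (hg c b hj hbk _).1]
  simp only [Equiv.trans_apply, Equiv.coe_mulLeft, Equiv.coe_mulRight, hgπ,
    Equiv.Perm.mul_apply]
  refine if_congr ?_ rfl rfl
  constructor
  · rintro ⟨h, hab⟩ i hi
    rcases Nat.lt_succ_iff_lt_or_eq.mp hi with hi | hi
    · have := h i hi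
      rw [hfix a ha i hi] at this
      rw [Equiv.swap_apply_eq_iff.mp this, hfix b hb i hi]
    · obtain rfl : i = c := Fin.ext hi
      rw [Equiv.swap_apply_right, Equiv.swap_apply_eq_iff, Equiv.swap_apply_right] at hab
      exact hab
  · intro h
    refine ⟨fun i hi => ?_, ?_⟩
    · rw [hfix a ha i hi, h i (by omega), hfix b hb i hi]
    · rw [Equiv.swap_apply_right, h c (by simp [hc]), Equiv.swap_apply_left]

/-- The letters from `j` up to `k - 1`. -/
def lettersIco (n j k : ℕ) : Finset (Fin n) :=
  Finset.univ.filter fun i => j ≤ (i : ℕ) ∧ (i : ℕ) < k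

lemma mem_lettersIco {n j k : ℕ} {i : Fin n} :
    i ∈ lettersIco n j k ↔ j ≤ (i : ℕ) ∧ (i : ℕ) < k := by
  simp [lettersIco]

lemma card_lettersIco {n j k : ℕ} (hk : k ≤ n) : (lettersIco n j k).card = k - j := by
  rw [← Nat.card_Ico, ← Finset.card_map Fin.valEmbedding]
  congr 1
  ext x
  simp only [Finset.mem_map, mem_lettersIco, Fin.valEmbedding_apply, Finset.mem_Ico]
  constructor
  · rintro ⟨i, hi, rfl⟩
    exact hi
  · intro hx
    exact ⟨⟨x, by omega⟩, hx, rfl⟩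

lemma crossings_of_fixing {n k j : ℕ} (hk : k ≤ n) (hj : j ≤ k) {π : Equiv.Perm (Fin n)}
    (hπ : ∀ i : Fin n, (i : ℕ) < j → π i = i) :
    crossings k π = ((k : ℤ) - j) -
      ∑ a ∈ lettersIco n j k, ∑ b ∈ lettersIco n j k, if π a = b then 1 else 0 := by
  have hge : ∀ i : Fin n, j ≤ (i : ℕ) → j ≤ (π i : ℕ) := by
    intro i hi
    by_contra! h
    have := π.injective (hπ (π i) h)
    rw [this] at h
    omega
  have hcard : ((k : ℤ) - j) = ∑ _a ∈ lettersIco n j k, (1 : ℤ) := by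
    rw [Finset.sum_const, card_lettersIco hk]
    simp [hj]
  rw [hcard, ← Finset.sum_sub_distrib, crossings,
    ← Finset.sum_subset (Finset.subset_univ (lettersIco n j k))]
  · refine Finset.sum_congr rfl fun i hi => ?_
    have hi' := mem_lettersIco.mp hi
    have := hge i hi'.1
    rw [Finset.sum_ite_eq]
    by_cases h : (π i : ℕ) < k
    · rw [if_neg (by omega), if_pos (mem_lettersIco.mpr ⟨this, h⟩)]
      rfl
    · rw [if_pos (by omega), if_neg (fun h' => h (mem_lettersIco.mp h').2)]
      rfl
  · intro i _ hi
    rw [if_neg]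
    rintro ⟨h1, h2⟩
    rcases lt_or_ge (i : ℕ) j with h | h
    · rw [hπ i h] at h2
      omega
    · exact hi (mem_lettersIco.mpr ⟨h, h1⟩)

/-- Multiplication by the number of crossings, on the level of symmetrized sums: once the letters
below `j` are fixed, each of the `(k - j) ^ 2` ways for a letter to stay below `k` contributes
the same as fixing the letter `j`. -/
lemma fixingSum_crossings_mul {n k j : ℕ} {g : Equiv.Perm (Fin n) → ℤ} (hg : InvariantBelow k g)
    (hk : k ≤ n) (hj : j ≤ k) :
    fixingSum j (fun π => crossings k π * g π) =
      ((k : ℤ) - j) * fixingSum j g - ((k : ℤ) - j) ^ 2 * fixingSum (j + 1) g := by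
  have hstep : fixingSum j (fun π => crossings k π * g π) = ((k : ℤ) - j) * fixingSum j g -
      ∑ a ∈ lettersIco n j k, ∑ b ∈ lettersIco n j k, ∑ π : Equiv.Perm (Fin n),
        if (∀ i : Fin n, (i : ℕ) < j → π i = i) ∧ π a = b then g π else 0 := by
    rw [Finset.sum_congr rfl (fun a _ => Finset.sum_comm), Finset.sum_comm, fixingSum, fixingSum,
      Finset.mul_sum, ← Finset.sum_sub_distrib]
    refine Finset.sum_congr rfl fun π _ => ?_
    by_cases hπ : ∀ i : Fin n, (i : ℕ) < j → π i = i
    · simp only [crossings_of_fixing hk hj hπ, sub_mul, Finset.sum_mul, ite_mul,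
        one_mul, zero_mul, eq_true hπ, true_and, if_true]
    · simp [hπ]
  have hsum : ∑ a ∈ lettersIco n j k, ∑ b ∈ lettersIco n j k, ∑ π : Equiv.Perm (Fin n),
      (if (∀ i : Fin n, (i : ℕ) < j → π i = i) ∧ π a = b then g π else 0) =
      ∑ _a ∈ lettersIco n j k, ∑ _b ∈ lettersIco n j k, fixingSum (j + 1) g := by
    refine Finset.sum_congr rfl fun a ha => Finset.sum_congr rfl fun b hb => ?_
    rw [mem_lettersIco] at ha hb
    exact sum_fixing_apply_eq hg hk (ha.1.trans_lt ha.2) ha.1 ha.2 hb.1 hb.2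
  rw [hstep, hsum, Finset.sum_const, Finset.sum_const, card_lettersIco hk, nsmul_eq_mul,
    nsmul_eq_mul, Nat.cast_sub hj]
  ring

lemma fixingSum_crossingIncrement_mul {n k j : ℕ} {g : Equiv.Perm (Fin n) → ℤ}
    (hg : InvariantBelow k g) (hk : k ≤ n) (hj : j ≤ k) :
    fixingSum j (fun π => crossingIncrement k π * g π) =
      (6 * ((k : ℤ) - j) - (2 * (k : ℤ) - 1)) * fixingSum j g -
        6 * ((k : ℤ) - j) ^ 2 * fixingSum (j + 1) g := by
  have h : fixingSum j (fun π => crossingIncrement k π * g π) =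
      6 * fixingSum j (fun π => crossings k π * g π) - (2 * (k : ℤ) - 1) * fixingSum j g := by
    simp only [fixingSum, Finset.mul_sum, ← Finset.sum_sub_distrib]
    refine Finset.sum_congr rfl fun π _ => ?_
    split_ifs
    · rw [crossingIncrement]
      ring
    · ring
  rw [h, fixingSum_crossings_mul hg hk hj]
  ring

/-! ### The transfer recurrence -/

/-- The operator on coefficient sequences that corresponds to multiplication by the crossing
increment at level `k`; see `Represents.crossingIncrement_mul`. -/
def levelOp (k : ℤ) (w : ℕ → ℤ) : ℕ → ℤ
  | 0 => (6 * k - (2 * k - 1)) * w 0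
  | j + 1 => (6 * (k - (j + 1)) - (2 * k - 1)) * w (j + 1) - 6 * (k - j) ^ 2 * w j

/-- If `w a` represents `s ^ a * f` and the crossing increment at level `k` is `h`, then
`pascalOp k w a` represents `s ^ a * (s + h) * f`. -/
def pascalOp (k : ℤ) (w : ℕ → ℕ → ℤ) (a : ℕ) : ℕ → ℤ :=
  fun j => w (a + 1) j + levelOp k (w a) j

/-- The coefficients `powerCoeff k r j` that express the symmetrized sum of the `r`-th power of
`centredCrossings k` through the sums over permutations fixing the letters below `j`. -/
def powerCoeff : ℕ → ℕ → ℕ → ℤ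
  | 0, _ => fun j => if j = 0 then 1 else 0
  | k + 1, r => (pascalOp (k + 1 : ℕ))^[r] (powerCoeff k) 0

lemma levelOp_eq_zero {k : ℕ} {w : ℕ → ℤ} (hw : ∀ j, k < j → w j = 0) :
    ∀ j, k < j → levelOp k w j = 0
  | 0, h => by simp at h
  | j + 1, h => by
    rw [levelOp, hw _ h]
    rcases Nat.lt_succ_iff_lt_or_eq.mp h with h | rfl
    · simp [hw _ h]
    · simp

lemma iterate_pascalOp_eq_zero {k : ℕ} {w : ℕ → ℕ → ℤ} (hw : ∀ a j, k < j → w a j = 0) (b : ℕ) :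
    ∀ a j, k < j → (pascalOp k)^[b] w a j = 0 := by
  induction b with
  | zero => exact hw
  | succ b ih =>
    intro a j hj
    rw [Function.iterate_succ_apply', pascalOp, ih _ _ hj, levelOp_eq_zero (ih a) j hj, add_zero]

lemma powerCoeff_eq_zero_of_level_lt : ∀ k r j : ℕ, k < j → powerCoeff k r j = 0
  | 0, _, j, h => if_neg (by omega)
  | k + 1, r, j, h => iterate_pascalOp_eq_zero
      (fun a i hi => powerCoeff_eq_zero_of_level_lt k a i (by omega)) r 0 j h

lemma iterate_pascalOp_eq_zero_of_add_lt {k : ℤ} {w : ℕ → ℕ → ℤ}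
    (hw : ∀ a j, a < j → w a j = 0) (b : ℕ) :
    ∀ a j, a + b < j → (pascalOp k)^[b] w a j = 0 := by
  induction b with
  | zero => exact hw
  | succ b ih =>
    intro a j hj
    obtain ⟨j, rfl⟩ := Nat.exists_eq_add_one_of_ne_zero (by omega : j ≠ 0)
    rw [Function.iterate_succ_apply', pascalOp, levelOp, ih _ _ (by omega), ih _ _ (by omega),
      ih _ _ (by omega)]
    ring

lemma powerCoeff_eq_zero_of_power_lt : ∀ k r j : ℕ, r < j → powerCoeff k r j = 0
  | 0, _, j, h => if_neg (by omega)
  | k + 1, r, j, h => iterate_pascalOp_eq_zero_of_add_lt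
      (fun a i hi => powerCoeff_eq_zero_of_power_lt k a i hi) r 0 j (by omega)

/-- `f` is indistinguishable from the combination with coefficients `w j` of the indicators of
"all letters below `j` are fixed", when tested against functions invariant below `k`. -/
def Represents {n : ℕ} (k : ℕ) (w : ℕ → ℤ) (f : Equiv.Perm (Fin n) → ℤ) : Prop :=
  ∀ g : Equiv.Perm (Fin n) → ℤ, InvariantBelow k g →
    ∑ π, f π * g π = ∑ j ∈ Finset.range (n + 1), w j * fixingSum j g

lemma Represents.crossingIncrement_mul {n k : ℕ} {w : ℕ → ℤ} {f : Equiv.Perm (Fin n) → ℤ}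
    (h : Represents k w f) (hk : k ≤ n) (hw : ∀ j, k < j → w j = 0) :
    Represents k (levelOp k w) (fun π => f π * crossingIncrement k π) := by
  intro g hg
  simp only [mul_assoc]
  rw [h _ ((invariantBelow_crossingIncrement k).mul hg)]
  have hterm : ∀ j, w j * fixingSum j (fun π => crossingIncrement k π * g π) =
      (6 * ((k : ℤ) - j) - (2 * (k : ℤ) - 1)) * w j * fixingSum j g -
        6 * ((k : ℤ) - j) ^ 2 * w j * fixingSum (j + 1) g := by
    intro j
    rcases lt_or_ge k j with hj | hj
    · simp [hw j hj]
    · rw [fixingSum_crossingIncrement_mul hg hk hj]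
      ring
  -- The top term of the shifted sum vanishes: `w n = 0` unless `k = n`.
  have htop : 6 * ((k : ℤ) - n) ^ 2 * w n * fixingSum (n + 1) g = 0 := by
    rcases hk.lt_or_eq with hk | rfl
    · simp [hw n hk]
    · simp
  rw [Finset.sum_congr rfl (fun j _ => hterm j), Finset.sum_sub_distrib,
    Finset.sum_range_succ (fun j => 6 * ((k : ℤ) - j) ^ 2 * w j * fixingSum (j + 1) g), htop,
    add_zero, Finset.sum_range_succ', Finset.sum_range_succ', add_sub_right_comm,
    ← Finset.sum_sub_distrib]
  congr 1
  refine Finset.sum_congr rfl fun j _ => ?_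
  rw [levelOp]
  push_cast
  ring

/-- The recurrence step: raising the level by one adds the crossing increment to the base. -/
lemma represents_iterate_pascalOp {n k : ℕ} (hk : k + 1 ≤ n)
    (ih : ∀ r, Represents (n := n) k (powerCoeff k r) fun π => centredCrossings k π ^ r) (b : ℕ) :
    ∀ a, Represents (n := n) (k + 1) ((pascalOp (k + 1 : ℕ))^[b] (powerCoeff k) a)
      fun π => centredCrossings k π ^ a * centredCrossings (k + 1) π ^ b := by
  induction b with
  | zero =>
    intro a g hg
    simpa using ih a g (hg.mono k.le_succ)
  | succ b hb =>
    intro a g hg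
    have h1 := hb (a + 1) g hg
    have h2 := (hb a).crossingIncrement_mul hk
      (iterate_pascalOp_eq_zero
        (fun a i hi => powerCoeff_eq_zero_of_level_lt k a i (by omega)) b a) g hg
    rw [Function.iterate_succ_apply']
    simp only [pascalOp, add_mul, Finset.sum_add_distrib]
    rw [← h1, ← h2, ← Finset.sum_add_distrib]
    refine Finset.sum_congr rfl fun π _ => ?_
    rw [show ∀ x y z : ℤ, x ^ a * y ^ (b + 1) * z = x ^ a * y ^ b * z * y by intros; ring]
    nth_rw 2 [centredCrossings_succ]
    ring

lemma represents_powerCoeff {n : ℕ} : ∀ k, k ≤ n → ∀ r,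
    Represents (n := n) k (powerCoeff k r) fun π => centredCrossings k π ^ r
  | 0, _, r => by
    intro g _
    simp [centredCrossings_zero, powerCoeff, fixingSum_zero]
  | k + 1, hk, r => by
    have h := represents_iterate_pascalOp hk (represents_powerCoeff k (by omega)) r 0
    simp only [pow_zero, one_mul] at h
    exact h

/-- The sum over all permutations of the `r`-th power of three times the centred footrule. -/
def powerSum (n r : ℕ) : ℤ :=
  ∑ j ∈ Finset.range (n + 1), powerCoeff n r j * ((n - j).factorial : ℤ)

lemma sum_centred_footrule_pow (n r : ℕ) :
    ∑ π : Equiv.Perm (Fin n), (3 * footrule π - ((n : ℤ) ^ 2 - 1)) ^ r = powerSum n r := by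
  have h := represents_powerCoeff n le_rfl r (fun _ => 1) (fun _ _ _ _ _ => ⟨rfl, rfl⟩)
  simp only [centredCrossings_self, mul_one] at h
  rw [h, powerSum]
  refine Finset.sum_congr rfl fun j hj => ?_
  rw [fixingSum_one (by simpa [Nat.lt_succ_iff] using hj)]

/-! ### Polynomial dependence on the level -/

/-- `f` agrees on all natural numbers with a rational polynomial of degree at most `d`. -/
def IsPolyOfDegreeLE (d : ℕ) (f : ℕ → ℚ) : Prop :=
  ∃ q : ℚ[X], q.natDegree ≤ d ∧ ∀ n : ℕ, f n = q.eval (n : ℚ)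

namespace IsPolyOfDegreeLE

variable {d e : ℕ} {f g : ℕ → ℚ}

lemma mono (hf : IsPolyOfDegreeLE d f) (h : d ≤ e) : IsPolyOfDegreeLE e f := by
  obtain ⟨q, hq, hfq⟩ := hf
  exact ⟨q, hq.trans h, hfq⟩

lemma congr (hf : IsPolyOfDegreeLE d f) (h : ∀ n, f n = g n) : IsPolyOfDegreeLE d g :=
  (funext h : f = g) ▸ hf

lemma const (c : ℚ) : IsPolyOfDegreeLE d fun _ => c :=
  ⟨C c, by simp, by simp⟩

lemma add (hf : IsPolyOfDegreeLE d f) (hg : IsPolyOfDegreeLE d g) :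
    IsPolyOfDegreeLE d fun n => f n + g n := by
  obtain ⟨p, hp, hfp⟩ := hf
  obtain ⟨q, hq, hgq⟩ := hg
  exact ⟨p + q, natDegree_add_le_of_degree_le hp hq, fun n => by simp only [hfp, hgq, eval_add]⟩

lemma mul (hf : IsPolyOfDegreeLE d f) (hg : IsPolyOfDegreeLE e g) :
    IsPolyOfDegreeLE (d + e) fun n => f n * g n := by
  obtain ⟨p, hp, hfp⟩ := hf
  obtain ⟨q, hq, hgq⟩ := hg
  exact ⟨p * q, natDegree_mul_le_of_le hp hq, fun n => by simp only [hfp, hgq, eval_mul]⟩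

lemma sub (hf : IsPolyOfDegreeLE d f) (hg : IsPolyOfDegreeLE d g) :
    IsPolyOfDegreeLE d fun n => f n - g n := by
  obtain ⟨p, hp, hfp⟩ := hf
  obtain ⟨q, hq, hgq⟩ := hg
  exact ⟨p - q, (natDegree_sub_le _ _).trans (max_le hp hq),
    fun n => by simp only [hfp, hgq, eval_sub]⟩

lemma linear (a b : ℚ) : IsPolyOfDegreeLE 1 fun n => a * n + b :=
  ⟨C a * X + C b, natDegree_linear_le, by simp⟩

lemma finset_sum {ι : Type*} (s : Finset ι) {F : ι → ℕ → ℚ}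
    (h : ∀ i ∈ s, IsPolyOfDegreeLE d (F i)) : IsPolyOfDegreeLE d fun n => ∑ i ∈ s, F i n := by
  classical
  induction s using Finset.induction_on with
  | empty => simpa using const 0
  | insert a s ha ih =>
    simp only [Finset.sum_insert ha]
    exact (h a (Finset.mem_insert_self a s)).add
      (ih fun i hi => h i (Finset.mem_insert_of_mem hi))

lemma sum_range_pow (p : ℕ) :
    IsPolyOfDegreeLE (p + 1) fun n => ∑ k ∈ Finset.range n, (k : ℚ) ^ p := by
  simp only [_root_.sum_range_pow]
  refine finset_sum _ fun i _ => ?_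
  refine ⟨C (_root_.bernoulli i * ((p + 1).choose i) / (p + 1)) * X ^ (p + 1 - i),
    (natDegree_C_mul_X_pow_le _ _).trans (Nat.sub_le _ _), fun n => ?_⟩
  simp only [eval_mul, eval_C, eval_pow, eval_X]
  ring

lemma sum_range (hf : IsPolyOfDegreeLE d f) :
    IsPolyOfDegreeLE (d + 1) fun n => ∑ k ∈ Finset.range n, f k := by
  obtain ⟨q, hq, hfq⟩ := hf
  have h : ∀ n : ℕ, ∑ k ∈ Finset.range n, f k =
      ∑ i ∈ Finset.range (q.natDegree + 1),
        q.coeff i * ∑ k ∈ Finset.range n, (k : ℚ) ^ i := by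
    intro n
    simp only [hfq, eval_eq_sum_range, Finset.mul_sum]
    exact Finset.sum_comm
  simp only [h]
  refine finset_sum _ fun i hi => ?_
  have hi : i < q.natDegree + 1 := Finset.mem_range.mp hi
  exact ((const (d := 0) (q.coeff i)).mul (sum_range_pow i)).mono (by omega)

lemma of_sub (h : IsPolyOfDegreeLE d fun n => f (n + 1) - f n) :
    IsPolyOfDegreeLE (d + 1) f := by
  have := h.sum_range.add (const (f 0))
  simpa only [Finset.sum_range_sub, sub_add_cancel] using this

end IsPolyOfDegreeLE

/-- The `j`-th terms of the sequences `w k` are polynomial in `k` of degree at most `d + j`. -/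
def IsPolyFamily (d : ℕ) (w : ℕ → ℕ → ℤ) : Prop :=
  ∀ j, IsPolyOfDegreeLE (d + j) fun k => (w k j : ℚ)

lemma IsPolyFamily.mono {d e : ℕ} {w : ℕ → ℕ → ℤ} (hw : IsPolyFamily d w) (h : d ≤ e) :
    IsPolyFamily e w :=
  fun j => (hw j).mono (by omega)

lemma IsPolyFamily.add {d : ℕ} {u w : ℕ → ℕ → ℤ} (hu : IsPolyFamily d u)
    (hw : IsPolyFamily d w) : IsPolyFamily d fun k j => u k j + w k j :=
  fun j => by simpa only [Int.cast_add] using (hu j).add (hw j)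

/-- Multiplication by a crossing increment raises the degree by one only, although it involves
the square of the level: this square comes with a shift of the index. -/
lemma IsPolyFamily.levelOp_succ {d : ℕ} {w : ℕ → ℕ → ℤ} (hw : IsPolyFamily d w) :
    IsPolyFamily (d + 1) fun k => levelOp (k + 1 : ℕ) (w k) := by
  rintro (_ | j)
  · refine (((IsPolyOfDegreeLE.linear 4 5).mul (hw 0)).mono (by omega)).congr fun k => ?_
    simp only [levelOp]
    push_cast
    ring
  · have h1 := ((IsPolyOfDegreeLE.linear 4 (-6 * j - 1)).mul (hw (j + 1))).mono
      (by omega : _ ≤ d + 1 + (j + 1))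
    have hl := IsPolyOfDegreeLE.linear 1 (1 - j)
    have h2 := (((IsPolyOfDegreeLE.const (d := 0) 6).mul (hl.mul hl)).mul (hw j)).mono
      (by omega : _ ≤ d + 1 + (j + 1))
    refine (h1.sub h2).congr fun k => ?_
    simp only [levelOp]
    push_cast
    ring

/-- Advancing the level changes the coefficients of the `r`-th power by terms of degree at most
`2 * r - 1`, since at least one factor is replaced by a crossing increment. -/
lemma isPolyFamily_iterate_pascalOp_sub {r : ℕ}
    (h : ∀ a < r, IsPolyFamily (2 * a) fun k => powerCoeff k a) (b : ℕ) :
    ∀ a, a + b ≤ r → IsPolyFamily (2 * (a + b) - 1) fun k j =>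
      (pascalOp (k + 1 : ℕ))^[b] (powerCoeff k) a j - powerCoeff k (a + b) j := by
  induction b with
  | zero =>
    intro a _ j
    simpa using IsPolyOfDegreeLE.const 0
  | succ b ih =>
    intro a hab
    have h1 := ih (a + 1) (by omega)
    have h2 : IsPolyFamily (2 * (a + b)) fun k j =>
        (pascalOp (k + 1 : ℕ))^[b] (powerCoeff k) a j := by
      simpa only [sub_add_cancel] using
        ((ih a (by omega)).mono (by omega)).add (h (a + b) (by omega))
    have h3 := (h1.mono (by omega : _ ≤ 2 * (a + (b + 1)) - 1)).add
      (h2.levelOp_succ.mono (by omega : _ ≤ 2 * (a + (b + 1)) - 1))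
    intro j
    refine (h3 j).congr fun k => ?_
    simp only [Function.iterate_succ_apply', pascalOp, add_right_comm a 1 b, add_assoc a b 1]
    rw [sub_add_eq_add_sub]

lemma isPolyFamily_powerCoeff (r : ℕ) : IsPolyFamily (2 * r) fun k => powerCoeff k r := by
  induction r using Nat.strong_induction_on with
  | _ r ih =>
    intro j
    rcases r.eq_zero_or_pos with rfl | hr
    · have : ∀ k, powerCoeff k 0 j = if j = 0 then 1 else 0 := by
        intro k
        induction k with
        | zero => rfl
        | succ k hk => exact hk
      simp only [this]
      exact IsPolyOfDegreeLE.const _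
    · have h := isPolyFamily_iterate_pascalOp_sub ih r 0 (by omega) j
      simp only [zero_add] at h
      refine (IsPolyOfDegreeLE.of_sub (d := 2 * r - 1 + j) (h.congr fun k => ?_)).mono (by omega)
      simp only [powerCoeff, Int.cast_sub]

/-! ### Polynomial moments -/

lemma descPochhammer_dvd_of_eval_eq_zero {q : ℚ[X]} {j : ℕ}
    (h : ∀ i < j, q.eval (i : ℚ) = 0) : descPochhammer ℚ j ∣ q := by
  induction j with
  | zero => simp
  | succ j ih =>
    obtain ⟨s, rfl⟩ := ih fun i hi => h i (by omega)
    have hj := h j j.lt_succ_self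
    rw [eval_mul, descPochhammer_eval_eq_descFactorial, Nat.descFactorial_self] at hj
    have hs : s.IsRoot (j : ℚ) :=
      (mul_eq_zero.mp hj).resolve_left (by exact_mod_cast j.factorial_ne_zero)
    rw [descPochhammer_succ_right]
    refine mul_dvd_mul_left _ ?_
    simpa using dvd_iff_isRoot.mpr hs

/-- Since the coefficient vanishes at the levels below `j`, division by the falling factorial of
length `j` leaves a polynomial, and lowers the degree bound by `j`. -/
lemma exists_poly_powerCoeff_mul_factorial (r j : ℕ) :
    ∃ q : ℚ[X], q.natDegree ≤ 2 * r ∧ ∀ n : ℕ, j ≤ n →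
      (powerCoeff n r j : ℚ) * ((n - j).factorial : ℚ) = (n.factorial : ℚ) * q.eval (n : ℚ) := by
  obtain ⟨p, hp, hpeval⟩ : ∃ p : ℚ[X], p.natDegree ≤ 2 * r + j ∧
      ∀ n : ℕ, (powerCoeff n r j : ℚ) = p.eval (n : ℚ) := isPolyFamily_powerCoeff r j
  obtain ⟨q, rfl⟩ : descPochhammer ℚ j ∣ p := descPochhammer_dvd_of_eval_eq_zero fun i hi => by
    rw [← hpeval, powerCoeff_eq_zero_of_level_lt i r j hi, Int.cast_zero]
  refine ⟨q, ?_, fun n hn => ?_⟩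
  · rcases eq_or_ne q 0 with rfl | hq
    · simp
    · rw [(monic_descPochhammer ℚ j).natDegree_mul' hq, descPochhammer_natDegree] at hp
      omega
  · rw [hpeval, eval_mul, descPochhammer_eval_eq_descFactorial,
      ← Nat.factorial_mul_descFactorial hn]
    push_cast
    ring

lemma powerSum_eq_sum_range_of_le {n r : ℕ} (h : r ≤ n) :
    powerSum n r =
      ∑ j ∈ Finset.range (r + 1), powerCoeff n r j * ((n - j).factorial : ℤ) := by
  refine (Finset.sum_subset (Finset.range_mono (by omega)) fun j _ hj => ?_).symm
  rw [powerCoeff_eq_zero_of_power_lt n r j (by simpa using hj), zero_mul]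

lemma exists_poly_powerSum (r : ℕ) :
    ∃ q : ℚ[X], q.natDegree ≤ 2 * r ∧ ∀ n : ℕ, r ≤ n →
      (powerSum n r : ℚ) = (n.factorial : ℚ) * q.eval (n : ℚ) := by
  choose q hq hqeval using exists_poly_powerCoeff_mul_factorial r
  refine ⟨∑ j ∈ Finset.range (r + 1), q j, natDegree_sum_le_of_forall_le _ _ fun j _ => hq j,
    fun n hn => ?_⟩
  rw [powerSum_eq_sum_range_of_le hn, eval_finsetSum, Finset.mul_sum]
  push_cast
  refine Finset.sum_congr rfl fun j hj => hqeval j n ?_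
  have : j < r + 1 := Finset.mem_range.mp hj
  omega

/-- Agreement at the `2 * r + 1` points from `r` to `3 * r` suffices. -/
lemma powerSum_eq_of_forall_lt {r : ℕ} {p : ℚ[X]} (hp : p.natDegree ≤ 2 * r)
    (h : ∀ i < 2 * r + 1, (powerSum (r + i) r : ℚ) =
      ((r + i).factorial : ℚ) * p.eval ((r + i : ℕ) : ℚ)) {n : ℕ} (hn : r ≤ n) :
    (powerSum n r : ℚ) = (n.factorial : ℚ) * p.eval (n : ℚ) := by
  obtain ⟨q, hq, hqeval⟩ := exists_poly_powerSum r
  have hinj : Function.Injective fun i : Fin (2 * r + 1) => ((r + i : ℕ) : ℚ) := by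
    intro a b hab
    simp only [Nat.cast_inj] at hab
    exact Fin.ext (by omega)
  have hpq : p = q := by
    refine eq_of_natDegree_lt_card_of_eval_eq p q hinj (fun i => ?_) ?_
    · have h1 := h i i.isLt
      rw [hqeval _ (by omega)] at h1
      exact (mul_left_cancel₀ (by exact_mod_cast Nat.factorial_ne_zero _) h1).symm
    · rw [Fintype.card_fin]
      exact Nat.lt_succ_of_le (max_le hp hq)
  rw [hqeval n hn, hpq]

/-! ### Evaluation by tables -/

/-- `f z`, in a form that makes the kernel evaluate `z` to a literal before it unfolds `f`: the
case distinctions on `z` need its value. Without this, `z` would be passed on unevaluated and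
duplicated. -/
def forceInt {α : Type*} (z : ℤ) (f : ℤ → α) : α :=
  match z with
  | .ofNat 0 => f (.ofNat 0)
  | .ofNat (n + 1) => f (.ofNat (n + 1))
  | .negSucc 0 => f (.negSucc 0)
  | .negSucc (n + 1) => f (.negSucc (n + 1))

/-- `f l`, evaluating the entries of `l` first. -/
def forceList {α : Type*} : List ℤ → (List ℤ → α) → α
  | [], f => f []
  | z :: l, f => forceInt z fun z' => forceList l fun l' => f (z' :: l')

/-- `f t`, evaluating the entries of `t` first. -/
def forceTable {α : Type*} : List (List ℤ) → (List (List ℤ) → α) → α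
  | [], f => f []
  | l :: t, f => forceList l fun l' => forceTable t fun t' => f (l' :: t')

lemma forceInt_eq {α : Type*} (z : ℤ) (f : ℤ → α) : forceInt z f = f z := by
  rcases z with (_ | n) | (_ | n) <;> rfl

lemma forceList_eq {α : Type*} (l : List ℤ) : ∀ f : List ℤ → α, forceList l f = f l := by
  induction l with
  | nil => intro f; rfl
  | cons z l ih => intro f; rw [forceList, forceInt_eq, ih]

lemma forceTable_eq {α : Type*} (t : List (List ℤ)) :
    ∀ f : List (List ℤ) → α, forceTable t f = f t := by
  induction t with
  | nil => intro f; rfl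
  | cons l t ih => intro f; rw [forceTable, forceList_eq, ih]

/-- `levelOp k` on a list of consecutive terms. If the first of them has index `j`, then `c` is
`4 * k + 1 - 6 * j`, `m` is `k + 1 - j`, and `p` is the term before it. -/
def levelRow (c m p : ℤ) : List ℤ → List ℤ
  | [] => []
  | x :: l => (c * x - 6 * (m * m * p)) :: levelRow (c - 6) (m - 1) x l

/-- `pascalOp k` on a list of truncated sequences; the result is shorter by one. -/
def pascalRows (k : ℤ) : List (List ℤ) → List (List ℤ)
  | s :: t :: l =>
    List.zipWith (· + ·) t (levelRow (4 * k + 1) (k + 1) 0 s) :: pascalRows k (t :: l)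
  | _ => []

/-- The heads of the first `m` iterates of `pascalRows k`. -/
def nextTable (k : ℤ) : ℕ → List (List ℤ) → List (List ℤ)
  | 0, _ => []
  | m + 1, t => forceTable (pascalRows k t) fun t' => t.headD [] :: nextTable k m t'

/-- The table of the coefficients `powerCoeff n a j` for `a` and `j` up to `r`. -/
def coeffTable (r : ℕ) : ℕ → List (List ℤ)
  | 0 => List.replicate (r + 1) (1 :: List.replicate r 0)
  | n + 1 => forceTable (coeffTable r n) fun t => nextTable (n + 1 : ℕ) (r + 1) t

/-- The sum of the `i`-th entry times `(n - i)!`. -/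
def factorialSum : ℕ → List ℤ → ℤ
  | _, [] => 0
  | n, x :: l => x * (n.factorial : ℤ) + factorialSum (n - 1) l

/-- Given the table `t` for `n`, the test whether `d` times the `r`-th power sum is
`3 ^ r * F` times the factorial at the `m` arguments from `n` on. -/
def checkPowerSums (r : ℕ) (d : ℤ) (F : ℤ → ℤ) : ℕ → ℕ → List (List ℤ) → Bool
  | 0, _, _ => true
  | m + 1, n, t =>
    decide (d * factorialSum n (t.getD r []) = 3 ^ r * n.factorial * F n) &&
      forceTable (nextTable (n + 1 : ℕ) (r + 1) t) (checkPowerSums r d F m (n + 1))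

lemma levelRow_range' (k : ℤ) (w : ℕ → ℤ) (m : ℕ) : ∀ s : ℕ,
    levelRow (4 * k + 1 - 6 * (s + 1)) (k - s) (w s) ((List.range' (s + 1) m).map w) =
      (List.range' (s + 1) m).map (levelOp k w) := by
  induction m with
  | zero => intro s; rfl
  | succ m ih =>
    intro s
    have h := ih (s + 1)
    push_cast at h
    rw [List.range'_succ, List.map_cons, List.map_cons, levelRow, sub_sub k,
      show 4 * k + 1 - 6 * ((s : ℤ) + 1) - 6 = 4 * k + 1 - 6 * (s + 1 + 1) by ring, h, levelOp]
    congr 1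
    ring

lemma levelRow_range (k : ℤ) (w : ℕ → ℤ) (m : ℕ) :
    levelRow (4 * k + 1) (k + 1) 0 ((List.range m).map w) = (List.range m).map (levelOp k w) := by
  rw [List.range_eq_range']
  cases m with
  | zero => rfl
  | succ m =>
    have h := levelRow_range' k w m 0
    simp only [Nat.cast_zero, zero_add, mul_one, sub_zero] at h
    rw [List.range'_succ, List.map_cons, List.map_cons, levelRow, add_sub_cancel_right, h,
      levelOp]
    congr 1
    ring

lemma pascalRows_range' (k : ℤ) (w : ℕ → ℕ → ℤ) (M m : ℕ) : ∀ s : ℕ,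
    pascalRows k ((List.range' s (m + 1)).map fun a => (List.range M).map (w a)) =
      (List.range' s m).map fun a => (List.range M).map (pascalOp k w a) := by
  induction m with
  | zero => intro s; rfl
  | succ m ih =>
    intro s
    have h := ih (s + 1)
    rw [List.range'_succ, List.map_cons] at h
    rw [List.range'_succ, List.range'_succ, List.map_cons, List.map_cons, pascalRows, h,
      List.range'_succ (s := s), List.map_cons, levelRow_range]
    congr 1
    rw [List.zipWith_map, List.zipWith_self]
    rfl

lemma nextTable_range (k : ℤ) (M m : ℕ) : ∀ w : ℕ → ℕ → ℤ,
    nextTable k m ((List.range m).map fun a => (List.range M).map (w a)) =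
      (List.range m).map fun b => (List.range M).map ((pascalOp k)^[b] w 0) := by
  induction m with
  | zero => intro w; rfl
  | succ m ih =>
    intro w
    have h : pascalRows k ((List.range (m + 1)).map fun a => (List.range M).map (w a)) =
        (List.range m).map fun a => (List.range M).map (pascalOp k w a) := by
      rw [List.range_eq_range' (n := m + 1), pascalRows_range', ← List.range_eq_range']
    rw [nextTable, forceTable_eq, h, ih, List.range_succ_eq_map, List.map_cons, List.map_cons,
      List.map_map, List.map_map]
    rfl

lemma coeffTable_eq (r n : ℕ) : coeffTable r n =
    (List.range (r + 1)).map fun a => (List.range (r + 1)).map (powerCoeff n a) := by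
  induction n with
  | zero =>
    have h : (List.range (r + 1)).map (fun j => if j = 0 then (1 : ℤ) else 0) =
        1 :: List.replicate r 0 := by
      rw [List.range_succ_eq_map, List.map_cons, List.map_map]
      simp [Function.comp_def]
    simp [coeffTable, powerCoeff, h]
  | succ n ih =>
    rw [coeffTable, forceTable_eq, ih, nextTable_range]
    rfl

lemma factorialSum_range' (n : ℕ) (u : ℕ → ℤ) (m : ℕ) : ∀ s : ℕ,
    factorialSum (n - s) ((List.range' s m).map u) =
      ∑ i ∈ Finset.range m, u (s + i) * ((n - (s + i)).factorial : ℤ) := by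
  induction m with
  | zero => intro s; rfl
  | succ m ih =>
    intro s
    rw [List.range'_succ, List.map_cons, factorialSum, Nat.sub_sub, ih, Finset.sum_range_succ',
      add_comm]
    simp only [add_zero, add_assoc, add_comm 1]

lemma factorialSum_coeffTable {n r : ℕ} (h : r ≤ n) :
    factorialSum n ((coeffTable r n).getD r []) = powerSum n r := by
  have hget : (coeffTable r n).getD r [] = (List.range' 0 (r + 1)).map (powerCoeff n r) := by
    rw [coeffTable_eq, ← List.range_eq_range']
    simp [List.getD]
  rw [hget, powerSum_eq_sum_range_of_le h]
  simpa using factorialSum_range' n (powerCoeff n r) (r + 1) 0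

lemma powerSum_of_checkPowerSums {r : ℕ} {d : ℤ} {F : ℤ → ℤ} (m : ℕ) : ∀ n : ℕ, r ≤ n →
    checkPowerSums r d F m n (coeffTable r n) = true → ∀ i < m,
      d * powerSum (n + i) r = 3 ^ r * (n + i).factorial * F (n + i : ℕ) := by
  induction m with
  | zero => intro n _ _ i hi; omega
  | succ m ih =>
    intro n hn h i hi
    rw [checkPowerSums, Bool.and_eq_true, decide_eq_true_eq, factorialSum_coeffTable hn,
      forceTable_eq, ← forceTable_eq (coeffTable r n) (nextTable _ _)] at h
    rcases i with _ | i
    · exact h.1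
    · rw [add_comm i 1, ← add_assoc]
      exact ih (n + 1) (by omega) h.2 i (by omega)

/-! ### Central moments -/

lemma powerSum_eq_of_checkPowerSums {r : ℕ} {p : ℚ[X]} (hp : p.natDegree ≤ 2 * r) {d : ℤ}
    (hd : d ≠ 0) {F : ℤ → ℤ} (hF : ∀ n : ℕ, (F n : ℚ) = d * p.eval (n : ℚ))
    (hcheck : checkPowerSums r d F (2 * r + 1) r (coeffTable r r) = true) {n : ℕ} (hn : r ≤ n) :
    (powerSum n r : ℚ) = 3 ^ r * (n.factorial : ℚ) * p.eval (n : ℚ) := by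
  rw [mul_comm (3 ^ r : ℚ), mul_assoc]
  have key := powerSum_eq_of_forall_lt (p := C (3 ^ r) * p)
    ((natDegree_C_mul_le _ _).trans hp) (fun i hi => ?_) hn
  · simpa using key
  · have h : (d : ℚ) * powerSum (r + i) r = 3 ^ r * (r + i).factorial * F (r + i : ℕ) := by
      exact_mod_cast powerSum_of_checkPowerSums _ r le_rfl hcheck i hi
    rw [hF] at h
    have hd' : (d : ℚ) ≠ 0 := by exact_mod_cast hd
    refine mul_left_cancel₀ hd' ?_
    rw [h, eval_mul, eval_C]
    ring

/-- The first centred power sum vanishes: the mean of the footrule is `(n ^ 2 - 1) / 3`. -/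
lemma powerSum_one {n : ℕ} (hn : 1 ≤ n) : powerSum n 1 = 0 := by
  have h := powerSum_eq_of_checkPowerSums (r := 1) (p := 0) (by simp) (d := 1) one_ne_zero
    (F := fun _ => 0) (by simp) (by decide +kernel) hn
  simpa using h

lemma uniformMean_footrule {n : ℕ} (hn : 1 ≤ n) :
    uniformMean (fun π : Equiv.Perm (Fin n) => (footrule π : ℚ)) = ((n : ℚ) ^ 2 - 1) / 3 := by
  have h := sum_centred_footrule_pow n 1
  simp only [pow_one, powerSum_one hn, Finset.sum_sub_distrib, ← Finset.mul_sum,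
    Finset.sum_const, Finset.card_univ, Fintype.card_perm, Fintype.card_fin, nsmul_eq_mul] at h
  have h' : 3 * ∑ π : Equiv.Perm (Fin n), (footrule π : ℚ) -
      (n.factorial : ℚ) * ((n : ℚ) ^ 2 - 1) = 0 := by
    have := congrArg (Int.cast : ℤ → ℚ) h
    push_cast at this
    linarith
  have hf : (n.factorial : ℚ) ≠ 0 := by exact_mod_cast n.factorial_ne_zero
  rw [uniformMean, Fintype.card_perm, Fintype.card_fin]
  field_simp
  linarith

lemma footruleMoment_eq_powerSum {n : ℕ} (hn : 1 ≤ n) (r : ℕ) :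
    footruleMoment n r = (powerSum n r : ℚ) / (3 ^ r * (n.factorial : ℚ)) := by
  rw [footruleMoment, uniformCentralMoment, uniformMean_footrule hn, uniformMean,
    Fintype.card_perm, Fintype.card_fin, ← div_div, ← sum_centred_footrule_pow]
  congr 1
  rw [Int.cast_sum, Finset.sum_div]
  refine Finset.sum_congr rfl fun π _ => ?_
  push_cast
  rw [← div_pow]
  congr 1
  ring

/-- The value at `x` of the polynomial with the coefficients `l`, constant term first. -/
def hornerEval {R : Type*} [CommRing R] (l : List ℤ) (x : R) : R :=
  l.foldr (fun (c : ℤ) y => (c : R) + x * y) 0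

lemma map_hornerEval {R S : Type*} [CommRing R] [CommRing S] (f : R →+* S) (l : List ℤ) (x : R) :
    f (hornerEval l x) = hornerEval l (f x) := by
  induction l with
  | nil => simp [hornerEval]
  | cons c l ih =>
    simp only [hornerEval, List.foldr_cons, map_add, map_mul, map_intCast] at ih ⊢
    rw [ih]

lemma natDegree_hornerEval_X (l : List ℤ) (a : ℤ) (ha : a ≠ 0) :
    hornerEval (l ++ [a]) (X : ℚ[X]) ≠ 0 ∧
      (hornerEval (l ++ [a]) (X : ℚ[X])).natDegree = l.length := by
  induction l with
  | nil => simp [hornerEval, ha]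
  | cons c l ih =>
    have h : hornerEval (c :: l ++ [a]) (X : ℚ[X]) =
        C (c : ℚ) + X * hornerEval (l ++ [a]) (X : ℚ[X]) := by
      simp [hornerEval]
    have hdeg : (hornerEval (c :: l ++ [a]) (X : ℚ[X])).natDegree = l.length + 1 := by
      rw [h, natDegree_C_add, natDegree_X_mul ih.1, ih.2]
    refine ⟨fun h0 => ?_, by rw [hdeg, List.length_cons]⟩
    rw [h0, natDegree_zero] at hdeg
    omega

/-- A candidate for the `r`-th moment, of the shape `c / d * (x + 2) ^ e * (x + 1) * Q x`, is
confirmed by the test at the arguments from `r` to `3 * r`. The coefficients of `Q` are `l`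
followed by the leading coefficient `a`. -/
lemma exists_poly_footruleMoment {r e : ℕ} {c d a : ℤ} (l : List ℤ) (hr : 1 ≤ r) (hc : c ≠ 0)
    (hd : d ≠ 0) (ha : a ≠ 0) (hdeg : e + 1 + l.length = 3 * r / 2)
    (hcheck : checkPowerSums r d
      (fun x => c * (x + 2) ^ e * (x + 1) * hornerEval (l ++ [a]) x) (2 * r + 1) r
      (coeffTable r r) = true) :
    (∀ n : ℕ, r ≤ n → footruleMoment n r =
      c * ((n : ℚ) + 2) ^ e * ((n : ℚ) + 1) * hornerEval (l ++ [a]) (n : ℚ) / d) ∧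
    ∃ P : ℚ[X], P.natDegree = 3 * r / 2 ∧
      ∀ n : ℕ, r ≤ n → footruleMoment n r = P.eval (n : ℚ) := by
  have hd' : (d : ℚ) ≠ 0 := by exact_mod_cast hd
  have hc' : (c : ℚ) ≠ 0 := by exact_mod_cast hc
  set P : ℚ[X] := C ((c : ℚ) / d) *
    ((X + C 2) ^ e * ((X + C 1) * hornerEval (l ++ [a]) X)) with hP
  have hPdeg : P.natDegree = 3 * r / 2 := by
    obtain ⟨h0, h1⟩ := natDegree_hornerEval_X l a ha
    rw [hP, natDegree_C_mul (div_ne_zero hc' hd'),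
      ((monic_X_add_C 2).pow e).natDegree_mul' (mul_ne_zero (X_add_C_ne_zero 1) h0),
      (monic_X_add_C 1).natDegree_mul' h0, natDegree_pow, natDegree_X_add_C, natDegree_X_add_C,
      h1]
    omega
  have hPeval : ∀ x : ℚ, P.eval x =
      c * (x + 2) ^ e * (x + 1) * hornerEval (l ++ [a]) x / d := by
    intro x
    have := map_hornerEval (evalRingHom x) (l ++ [a]) X
    rw [coe_evalRingHom, eval_X] at this
    simp only [hP, eval_mul, eval_C, eval_pow, eval_add, eval_X, this]
    ring
  have hF : ∀ n : ℕ, (((fun x : ℤ => c * (x + 2) ^ e * (x + 1) * hornerEval (l ++ [a]) x) n : ℤ)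
      : ℚ) = d * P.eval (n : ℚ) := by
    intro n
    have := map_hornerEval (Int.castRingHom ℚ) (l ++ [a]) (n : ℤ)
    simp only [eq_intCast, Int.cast_natCast] at this
    rw [hPeval, mul_div_cancel₀ _ hd']
    push_cast
    rw [this]
  have hmain : ∀ n : ℕ, r ≤ n → footruleMoment n r = P.eval (n : ℚ) := by
    intro n hn
    have hf : (n.factorial : ℚ) ≠ 0 := by exact_mod_cast n.factorial_ne_zero
    rw [footruleMoment_eq_powerSum (hr.trans hn),
      powerSum_eq_of_checkPowerSums (by omega) hd hF hcheck hn, mul_div_cancel_left₀]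
    exact mul_ne_zero (by positivity) hf
  exact ⟨fun n hn => by rw [hmain n hn, hPeval], P, hPdeg, hmain⟩

/-! ### The explicit moments -/

theorem mainTheorem1 :
    (∀ n : ℕ, 3 ≤ n → footruleMoment n 3 =
      (-2) * ((n : ℚ) + 2) * ((n : ℚ) + 1) *
        (2 * (n : ℚ) ^ 2 + 31) / 945) ∧
    (∀ n : ℕ, 4 ≤ n → footruleMoment n 4 =
      ((n : ℚ) + 1) *
        (28 * (n : ℚ) ^ 5 + 180 * (n : ℚ) ^ 3 + 160 * (n : ℚ) ^ 2 + 887 * (n : ℚ) + 1265) / 4725) ∧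
    (∀ n : ℕ, 5 ≤ n → footruleMoment n 5 =
      (-4) * ((n : ℚ) + 2) * ((n : ℚ) + 1) *
        (44 * (n : ℚ) ^ 5 - 10 * (n : ℚ) ^ 4 + 788 * (n : ℚ) ^ 3 + 86 * (n : ℚ) ^ 2
          + 3587 * (n : ℚ) + 8555) / 93555) ∧
    (∀ n : ℕ, 6 ≤ n → footruleMoment n 6 =
      ((n : ℚ) + 1) *
        (168168 * (n : ℚ) ^ 8 - 145288 * (n : ℚ) ^ 7 + 1800148 * (n : ℚ) ^ 6
          + 2180892 * (n : ℚ) ^ 5 + 18508182 * (n : ℚ) ^ 4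
          + 32547228 * (n : ℚ) ^ 3 + 112117257 * (n : ℚ) ^ 2
          + 385870348 * (n : ℚ) + 368963105) / 127702575) ∧
    (∀ n : ℕ, 7 ≤ n → footruleMoment n 7 =
      (-2) * ((n : ℚ) + 2) * ((n : ℚ) + 1) *
        (8008 * (n : ℚ) ^ 8 - 11648 * (n : ℚ) ^ 7 + 171164 * (n : ℚ) ^ 6
          - 88560 * (n : ℚ) ^ 5 + 1645002 * (n : ℚ) ^ 4 + 2988888 * (n : ℚ) ^ 3
          + 4890161 * (n : ℚ) ^ 2 + 46078520 * (n : ℚ) + 73541545) / 18243225) ∧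
    (∀ n : ℕ, 8 ≤ n → footruleMoment n 8 =
      ((n : ℚ) + 1) *
        (5717712 * (n : ℚ) ^ 11 - 14041456 * (n : ℚ) ^ 10 + 111237120 * (n : ℚ) ^ 9
          + 63288800 * (n : ℚ) ^ 8 + 1347724536 * (n : ℚ) ^ 7
          + 1996817312 * (n : ℚ) ^ 6 + 17098013040 * (n : ℚ) ^ 5
          + 53375545600 * (n : ℚ) ^ 4 + 125630091477 * (n : ℚ) ^ 3
          + 758605059019 * (n : ℚ) ^ 2 + 2016696623115 * (n : ℚ) + 1690532291725) / 13956067125) ∧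
    (∀ n : ℕ, 9 ≤ n → footruleMoment n 9 =
      (-8) * ((n : ℚ) + 2) * ((n : ℚ) + 1) *
        (325909584 * (n : ℚ) ^ 11 - 1185159352 * (n : ℚ) ^ 10 + 9805807128 * (n : ℚ) ^ 9
          - 16336808896 * (n : ℚ) ^ 8 + 137996736504 * (n : ℚ) ^ 7
          + 46247875310 * (n : ℚ) ^ 6 + 758421298152 * (n : ℚ) ^ 5
          + 6095266855096 * (n : ℚ) ^ 4 + 6075969746037 * (n : ℚ) ^ 3
          + 57909124031467 * (n : ℚ) ^ 2 + 310708670730195 * (n : ℚ)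
          + 412170672282775) / 5568470782875) ∧
    (∀ n : ℕ, 10 ≤ n → footruleMoment n 10 =
      ((n : ℚ) + 1) *
        (16730025312 * (n : ℚ) ^ 14 - 77618212672 * (n : ℚ) ^ 13
          + 613234099632 * (n : ℚ) ^ 12 - 579463689632 * (n : ℚ) ^ 11
          + 7657390179296 * (n : ℚ) ^ 10 + 4566116902864 * (n : ℚ) ^ 9
          + 146567796905816 * (n : ℚ) ^ 8 + 264922488779784 * (n : ℚ) ^ 7
          + 1660374425319302 * (n : ℚ) ^ 6 + 11150634041788208 * (n : ℚ) ^ 5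
          + 25328167884268777 * (n : ℚ) ^ 4 + 156189484242864248 * (n : ℚ) ^ 3
          + 877883775625389940 * (n : ℚ) ^ 2 + 1953357983931868000 * (n : ℚ)
          + 1484183419415591125) / 102088631019375) ∧
    (∀ r : ℕ, 3 ≤ r → r ≤ 10 → ∃ P : ℚ[X], P.natDegree = 3 * r / 2 ∧
      ∀ n : ℕ, r ≤ n → footruleMoment n r = P.eval (n : ℚ)) := by
  -- The coefficient lists begin with the constant terms and omit the leading coefficients `a`.
  have h3 := exists_poly_footruleMoment (r := 3) (e := 1) (c := -2) (d := 945) (a := 2)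
    [31, 0]
    (by norm_num) (by norm_num) (by norm_num) (by norm_num) rfl (by decide +kernel)
  have h4 := exists_poly_footruleMoment (r := 4) (e := 0) (c := 1) (d := 4725) (a := 28)
    [1265, 887, 160, 180, 0]
    (by norm_num) (by norm_num) (by norm_num) (by norm_num) rfl (by decide +kernel)
  have h5 := exists_poly_footruleMoment (r := 5) (e := 1) (c := -4) (d := 93555) (a := 44)
    [8555, 3587, 86, 788, -10]
    (by norm_num) (by norm_num) (by norm_num) (by norm_num) rfl (by decide +kernel)
  have h6 := exists_poly_footruleMoment (r := 6) (e := 0) (c := 1) (d := 127702575) (a := 168168)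
    [368963105, 385870348, 112117257, 32547228, 18508182, 2180892, 1800148, -145288]
    (by norm_num) (by norm_num) (by norm_num) (by norm_num) rfl (by decide +kernel)
  have h7 := exists_poly_footruleMoment (r := 7) (e := 1) (c := -2) (d := 18243225) (a := 8008)
    [73541545, 46078520, 4890161, 2988888, 1645002, -88560, 171164, -11648]
    (by norm_num) (by norm_num) (by norm_num) (by norm_num) rfl (by decide +kernel)
  have h8 := exists_poly_footruleMoment (r := 8) (e := 0) (c := 1) (d := 13956067125)
    (a := 5717712)
    [1690532291725, 2016696623115, 758605059019, 125630091477, 53375545600, 17098013040,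
      1996817312, 1347724536, 63288800, 111237120, -14041456]
    (by norm_num) (by norm_num) (by norm_num) (by norm_num) rfl (by decide +kernel)
  have h9 := exists_poly_footruleMoment (r := 9) (e := 1) (c := -8) (d := 5568470782875)
    (a := 325909584)
    [412170672282775, 310708670730195, 57909124031467, 6075969746037, 6095266855096,
      758421298152, 46247875310, 137996736504, -16336808896, 9805807128, -1185159352]
    (by norm_num) (by norm_num) (by norm_num) (by norm_num) rfl (by decide +kernel)
  have h10 := exists_poly_footruleMoment (r := 10) (e := 0) (c := 1) (d := 102088631019375)
    (a := 16730025312)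
    [1484183419415591125, 1953357983931868000, 877883775625389940, 156189484242864248,
      25328167884268777, 11150634041788208, 1660374425319302, 264922488779784, 146567796905816,
      4566116902864, 7657390179296, -579463689632, 613234099632, -77618212672]
    (by norm_num) (by norm_num) (by norm_num) (by norm_num) rfl (by decide +kernel)
  refine ⟨?_, ?_, ?_, ?_, ?_, ?_, ?_, ?_, ?_⟩
  · intro n hn
    rw [h3.1 n hn]
    simp only [hornerEval, List.cons_append, List.nil_append, List.foldr_cons, List.foldr_nil]
    push_cast
    ring
  · intro n hn
    rw [h4.1 n hn]
    simp only [hornerEval, List.cons_append, List.nil_append, List.foldr_cons, List.foldr_nil]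
    push_cast
    ring
  · intro n hn
    rw [h5.1 n hn]
    simp only [hornerEval, List.cons_append, List.nil_append, List.foldr_cons, List.foldr_nil]
    push_cast
    ring
  · intro n hn
    rw [h6.1 n hn]
    simp only [hornerEval, List.cons_append, List.nil_append, List.foldr_cons, List.foldr_nil]
    push_cast
    ring
  · intro n hn
    rw [h7.1 n hn]
    simp only [hornerEval, List.cons_append, List.nil_append, List.foldr_cons, List.foldr_nil]
    push_cast
    ring
  · intro n hn
    rw [h8.1 n hn]
    simp only [hornerEval, List.cons_append, List.nil_append, List.foldr_cons, List.foldr_nil]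
    push_cast
    ring
  · intro n hn
    rw [h9.1 n hn]
    simp only [hornerEval, List.cons_append, List.nil_append, List.foldr_cons, List.foldr_nil]
    push_cast
    ring
  · intro n hn
    rw [h10.1 n hn]
    simp only [hornerEval, List.cons_append, List.nil_append, List.foldr_cons, List.foldr_nil]
    push_cast
    ring
  · intro r hr hr'
    interval_cases r
    exacts [h3.2, h4.2, h5.2, h6.2, h7.2, h8.2, h9.2, h10.2]
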